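/- **Definitions.** Let $(X,\rho,\mu)$ be a metric measure space. A *differentiation basis* assigns to every $x\in X$ a family $\mathcal B(x)$ of measurable sets $S$ with $x\in S$ and $0<\mu(S)<\infty$, such that for $\mu$-almost every $x$ there is at least one sequence contracting to $x$. Here a sequence $(S_n)_{n\in\mathbb N}$ *contracts to* $x$, written $(S_n)\Rightarrow x$, if $S_n\in\mathcal B(x)$ for all $n$ and there are radii $r_n>0$ with $r_n\to 0$ and $S_n\subseteq B(x,r_n)$ for all $n$. Its elements are the members of $\mathcal B=\bigcup_{x\in X}\mathcal B(x)$. It is a *Busemann–Feller basis* if $\mathcal B(x)=\{S\in\mathcal B: x\in S\}$ for every $x\in X$ and every $S\in\mathcal B$ is open. For $p\in[1,\infty]$, $\mathcal B$ *differentiates* $L^p(X)$ if for every $f\in L^p(X)$ and for $\mu$-almost every $x\in X$, $$\lim_{n\to\infty}\frac1{\mu(S_n)}\int_{S_n} f\,d\mu=f(x)\quad\text{for every sequence } (S_n)\Rightarrow x .$$ **Statement.** Let $p_0\in[1,\infty)$. Then there exist Busemann–Feller bases $\mathcal B^*_{\ge}$ and $\mathcal B^*_{>}$ in the unit interval $[0,1]$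 (with the Euclidean metric and Lebesgue measure), all of whose elements are finite unions of open intervals, such that for every $p\in[1,\infty]$: * $\mathcal B^*_{\ge}$ differentiates $L^p([0,1])$ if and only if $p\ge p_0$; * $\mathcal B^*_{>}$ differentiates $L^p([0,1])$ if and only if $p>p_0$. -/

import Mathlib

open MeasureTheory Filter
open scoped Topology ENNReal NNReal

/-- Given for every point `x` a family `B x` of sets, the sequence `S` *contracts to* `x` if
`S n ∈ B x` for every `n` and the sets `S n` lie in balls centred at `x` whose radii tend to `0`. -/
def ContractsTo {X : Type*} [MetricSpace X] (B : X → Set (Set X)) (S : ℕ → Set X) (x : X) : Prop :=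
  (∀ n, S n ∈ B x) ∧
    ∃ r : ℕ → ℝ, (∀ n, 0 < r n) ∧ Tendsto r atTop (𝓝 0) ∧ ∀ n, S n ⊆ Metric.ball x (r n)

/-- `B` is a *differentiation basis*: every member of `B x` is a measurable set that contains `x`
and has positive finite measure, and almost every point admits a sequence contracting to it. -/
def IsDifferentiationBasis {X : Type*} [MetricSpace X] [MeasurableSpace X] (μ : Measure X)
    (B : X → Set (Set X)) : Prop :=
  (∀ x, ∀ S ∈ B x, MeasurableSet S ∧ x ∈ S ∧ 0 < μ S ∧ μ S < ∞) ∧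
    ∀ᵐ x ∂μ, ∃ S : ℕ → Set X, ContractsTo B S x

/-- The elements of a basis: the whole family `⋃ x, B x`. -/
def basisSets {X : Type*} (B : X → Set (Set X)) : Set (Set X) :=
  ⋃ x, B x

/-- `B` is *uncentered*: every element of the basis is attached to each of its points. -/
def IsUncentered {X : Type*} (B : X → Set (Set X)) : Prop :=
  ∀ x, B x = {S | S ∈ basisSets B ∧ x ∈ S}

/-- A *Busemann–Feller basis* is an uncentered differentiation basis of open sets. -/
def IsBusemannFellerBasis {X : Type*} [MetricSpace X] [MeasurableSpace X] (μ : Measure X)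
    (B : X → Set (Set X)) : Prop :=
  IsDifferentiationBasis μ B ∧ IsUncentered B ∧ ∀ S ∈ basisSets B, IsOpen S

/-- `B` *differentiates* `L^p(μ)`: for every real-valued `f ∈ L^p(μ)`, for almost every `x`, the
averages of `f` over every sequence contracting to `x` converge to `f x`. -/
def DifferentiatesLp {X : Type*} [MetricSpace X] [MeasurableSpace X] (μ : Measure X)
    (B : X → Set (Set X)) (p : ℝ≥0∞) : Prop :=
  ∀ f : X → ℝ, MemLp f p μ →
    ∀ᵐ x ∂μ, ∀ S : ℕ → Set X, ContractsTo B S x →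
      Tendsto (fun n => ⨍ y in S n, f y ∂μ) atTop (𝓝 (f x))

/-- `S ⊆ [0,1]` is a finite union of open intervals `(a, b)` with `0 ≤ a < b ≤ 1`. -/
def IsFiniteUnionOfOpenIntervals (S : Set (Set.Icc (0 : ℝ) 1)) : Prop :=
  ∃ J : Finset (Set.Icc (0 : ℝ) 1 × Set.Icc (0 : ℝ) 1),
    (∀ q ∈ J, q.1 < q.2) ∧ S = ⋃ q ∈ J, Set.Ioo q.1 q.2

/-!
Both bases contain all open intervals; without further sets these differentiate `L^1`. At every
stage `k` one adds sets that connect most of `[0,1]` with a very small set. Divide `[0,1]` into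
`k + 1` equal coarse cells and each of those into `N k` equal fine cells of length `w`, and mark at
the left end of each coarse cell a core of length `τ k * w`, where `τ k = 2 ^ (-k ^ 2)`. The new
sets are the unions `J ∪ G` of a fine cell `J` with the core `G` of its coarse cell. The core has a
negligible share of the length of `J ∪ G`, but it is shared by `N k` sets that together fill the
coarse cell.

Whether `L^p` is differentiated depends on `N k * τ k ^ (p - 1)`.

* For `f ∈ L^p`, the contribution of `G` to the average over `J ∪ G` is at most `∫_G |f| / w`. By
  Jensen's inequality, the `p`-th power of this quantity, integrated over all coarse cells, is at
  most `N k * τ k ^ (p - 1) * ‖f‖_p ^ p`. If these numbers are summable, the contribution tends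
  to zero almost everywhere (`ae_eventually_lintegral_core_le`). Almost every point lies in
  finitely many cores, and what remains is Lebesgue's theorem for intervals
  (`ae_exists_lintegral_interval_le`). This gives `differentiatesLp_coreBasis`.
* The function equal to `1 / τ k` on the cores of stage `k` has average at least `1 / 2` over each
  `J ∪ G`, while the `p`-th power of its norm is `1 / (N k * τ k ^ (p - 1))`. If these numbers are
  summable, the supremum of the functions with `k ≥ K` (`coreSpike`) lies in `L^p`. Were `L^p`
  differentiated, it would be at least `1 / 2` almost everywhere, which its norm forbids for large
  `K`. This gives `not_differentiatesLp_coreBasis`.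

With `N k = ⌈2 ^ ((p₀ - 1) * k ^ 2 + σ * k)⌉` (`cellCount`) the product `N k * τ k ^ (p - 1)` is
about `2 ^ ((p₀ - p) * k ^ 2 + σ * k)`. It decays for `p > p₀`, grows for `p < p₀`, and at `p = p₀`
the sign of `σ = ∓1` decides. For `p₀ = 1` and `σ = -1` rounding up would spoil the decay at `p = 1`;
there `N = 0`, and the intervals alone suffice.
-/

/-! ### Intervals in `[0,1]` -/

/-- The trace on `[0,1]` of the open interval `(a, b)`, for arbitrary real endpoints. -/
def interval (a b : ℝ) : Set unitInterval := {x | a < (x : ℝ) ∧ (x : ℝ) < b}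

theorem interval_subset {a b c d : ℝ} (h₁ : c ≤ a) (h₂ : b ≤ d) : interval a b ⊆ interval c d :=
  fun _ hx => ⟨h₁.trans_lt hx.1, hx.2.trans_le h₂⟩

theorem isOpen_interval (a b : ℝ) : IsOpen (interval a b) :=
  (isOpen_lt continuous_const continuous_subtype_val).inter
    (isOpen_lt continuous_subtype_val continuous_const)

theorem measurableSet_interval (a b : ℝ) : MeasurableSet (interval a b) :=
  (isOpen_interval a b).measurableSet

theorem interval_eq_Ioo {a b : ℝ} (ha : a ∈ Set.Icc (0 : ℝ) 1) (hb : b ∈ Set.Icc (0 : ℝ) 1) :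
    interval a b = Set.Ioo (⟨a, ha⟩ : unitInterval) ⟨b, hb⟩ := rfl

theorem volume_interval {a b : ℝ} (ha : 0 ≤ a) (hab : a ≤ b) (hb : b ≤ 1) :
    volume (interval a b) = ENNReal.ofReal (b - a) := by
  rw [interval_eq_Ioo ⟨ha, hab.trans hb⟩ ⟨ha.trans hab, hb⟩]
  exact unitInterval.volume_Ioo _ _

/-- A ball that contains an interval has at least half its length as radius. -/
theorem sub_le_of_interval_subset_ball {a b r : ℝ} {x : unitInterval} (ha : 0 ≤ a) (hab : a < b)
    (hb : b ≤ 1) (h : interval a b ⊆ Metric.ball x r) : b - a ≤ 2 * r := by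
  have key : ∀ c, a < c → c < b → |c - x| < r := fun c h₁ h₂ => by
    have := h (show (⟨c, ha.trans h₁.le, h₂.le.trans hb⟩ : unitInterval) ∈ interval a b from
      ⟨h₁, h₂⟩)
    simpa [Subtype.dist_eq, Real.dist_eq] using this
  by_contra! hlt
  have h₁ := abs_lt.1 (key (a + (b - a - 2 * r) / 4 ⊓ (b - a) / 2) (by
    have : 0 < (b - a - 2 * r) / 4 ⊓ (b - a) / 2 := lt_min (by linarith) (by linarith)
    linarith) (by linarith [min_le_right ((b - a - 2 * r) / 4) ((b - a) / 2)]))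
  have h₂ := abs_lt.1 (key (b - (b - a - 2 * r) / 4 ⊓ (b - a) / 2) (by
    linarith [min_le_right ((b - a - 2 * r) / 4) ((b - a) / 2)]) (by
    have : 0 < (b - a - 2 * r) / 4 ⊓ (b - a) / 2 := lt_min (by linarith) (by linarith)
    linarith))
  linarith [min_le_left ((b - a - 2 * r) / 4) ((b - a) / 2)]

/-! ### Coarse cells, fine cells and cores -/

/-- The ratio between the length of a core and that of a fine cell at stage `k`. -/
noncomputable def coreRatio (k : ℕ) : ℝ := 2⁻¹ ^ k ^ 2

theorem coreRatio_pos (k : ℕ) : 0 < coreRatio k := by unfold coreRatio; positivity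

theorem coreRatio_le_one (k : ℕ) : coreRatio k ≤ 1 :=
  pow_le_one₀ (by norm_num) (by norm_num)

theorem coreRatio_le (k : ℕ) : coreRatio k ≤ 2⁻¹ ^ k :=
  pow_le_pow_of_le_one (by norm_num) (by norm_num) (Nat.le_self_pow two_ne_zero k)

/-- The length of the fine cells at stage `k`, of which each of the `k + 1` coarse cells holds
`N k`. It is the junk value `0` when `N k = 0`, where there are no fine cells. -/
noncomputable def width (N : ℕ → ℕ) (k : ℕ) : ℝ := (((k : ℝ) + 1) * N k)⁻¹

/-- The `m`-th of the `k + 1` intervals of equal length into which stage `k` divides `[0,1]`. -/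
def coarseCell (k m : ℕ) : Set unitInterval :=
  interval (m / ((k : ℝ) + 1)) ((m + 1) / ((k : ℝ) + 1))

/-- The `i`-th of the `N k` intervals of equal length that divide `coarseCell k m`. -/
def fineCell (N : ℕ → ℕ) (k m i : ℕ) : Set unitInterval :=
  interval (m / ((k : ℝ) + 1) + i * width N k) (m / ((k : ℝ) + 1) + (i + 1) * width N k)

/-- A short interval at the left end of `coarseCell k m`, attached in `coreFamily` to every fine
cell of that coarse cell. -/
def core (N : ℕ → ℕ) (k m : ℕ) : Set unitInterval :=
  interval (m / ((k : ℝ) + 1)) (m / ((k : ℝ) + 1) + coreRatio k * width N k)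

/-- All nondegenerate open intervals in `[0,1]`, and, at every stage `k`, the union of each fine
cell with the core of its coarse cell. -/
def coreFamily (N : ℕ → ℕ) : Set (Set unitInterval) :=
  {S | ∃ a b : ℝ, 0 ≤ a ∧ a < b ∧ b ≤ 1 ∧ S = interval a b} ∪
    {S | ∃ k m i, m < k + 1 ∧ i < N k ∧ S = fineCell N k m i ∪ core N k m}

/-- The uncentered basis with elements `coreFamily N`. -/
def coreBasis (N : ℕ → ℕ) (x : unitInterval) : Set (Set unitInterval) :=
  {S | S ∈ coreFamily N ∧ x ∈ S}

section Cells

variable {N : ℕ → ℕ} {k m i : ℕ}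

theorem width_pos (hN : 0 < N k) : 0 < width N k := by
  unfold width; have : (0 : ℝ) < N k := by exact_mod_cast hN
  positivity

theorem width_nonneg (N : ℕ → ℕ) (k : ℕ) : 0 ≤ width N k := by unfold width; positivity

theorem mul_width_le (N : ℕ → ℕ) (k : ℕ) : N k * width N k ≤ 1 / ((k : ℝ) + 1) := by
  unfold width
  rcases Nat.eq_zero_or_pos (N k) with h | h
  · simp only [h, Nat.cast_zero, zero_mul]; positivity
  · have : (0 : ℝ) < N k := by exact_mod_cast h
    exact le_of_eq (by field_simp)

theorem coarse_right_le (hm : m < k + 1) : ((m : ℝ) + 1) / ((k : ℝ) + 1) ≤ 1 := by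
  rw [div_le_one (by positivity)]
  exact_mod_cast hm

theorem fine_right_le (hi : i < N k) :
    m / ((k : ℝ) + 1) + (i + 1) * width N k ≤ (m + 1) / ((k : ℝ) + 1) := by
  have h₁ : ((i : ℝ) + 1) ≤ N k := by exact_mod_cast hi
  have := mul_le_mul_of_nonneg_right h₁ (width_nonneg N k)
  rw [add_div]
  linarith [mul_width_le N k]

theorem coreRatio_mul_width_le (N : ℕ → ℕ) (k : ℕ) : coreRatio k * width N k ≤ width N k :=
  mul_le_of_le_one_left (width_nonneg N k) (coreRatio_le_one k)

theorem core_right_le : m / ((k : ℝ) + 1) + coreRatio k * width N k ≤ (m + 1) / ((k : ℝ) + 1) := by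
  rcases Nat.eq_zero_or_pos (N k) with h | h
  · have : width N k = 0 := by simp [width, h]
    rw [this, mul_zero, add_zero]
    gcongr; linarith
  · have := fine_right_le (m := m) h
    have := coreRatio_mul_width_le N k
    simp only [Nat.cast_zero, zero_add, one_mul] at *
    linarith

theorem fineCell_subset (hi : i < N k) : fineCell N k m i ⊆ coarseCell k m :=
  interval_subset (le_add_of_nonneg_right (mul_nonneg (by positivity) (width_nonneg N k)))
    (fine_right_le hi)

theorem core_subset : core N k m ⊆ coarseCell k m :=
  interval_subset le_rfl core_right_le

theorem volume_fineCell (hm : m < k + 1) (hi : i < N k) :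
    volume (fineCell N k m i) = ENNReal.ofReal (width N k) := by
  have := width_nonneg N k
  rw [fineCell, volume_interval (by positivity) (by nlinarith)
    ((fine_right_le hi).trans (coarse_right_le hm))]
  congr 1; ring

theorem volume_core (hm : m < k + 1) :
    volume (core N k m) = ENNReal.ofReal (coreRatio k * width N k) := by
  have h₁ := mul_nonneg (coreRatio_pos k).le (width_nonneg N k)
  rw [core, volume_interval (by positivity) (by linarith)
    (core_right_le.trans (coarse_right_le hm))]
  congr 1; ring

theorem volume_coarseCell (hm : m < k + 1) :
    volume (coarseCell k m) = ENNReal.ofReal (1 / ((k : ℝ) + 1)) := by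
  rw [coarseCell, volume_interval (by positivity) (by gcongr; linarith) (coarse_right_le hm)]
  congr 1; ring

theorem disjoint_coarseCell (k : ℕ) {m m' : ℕ} (h : m ≠ m') :
    Disjoint (coarseCell k m) (coarseCell k m') := by
  wlog hlt : m < m' generalizing m m'
  · exact (this h.symm (lt_of_le_of_ne (not_lt.1 hlt) h.symm)).symm
  refine Set.disjoint_left.2 fun x hx hx' => ?_
  have h₁ : ((m : ℝ) + 1) / ((k : ℝ) + 1) ≤ m' / ((k : ℝ) + 1) := by
    gcongr; exact_mod_cast hlt
  exact absurd (hx.2.trans_le h₁) (not_lt.2 hx'.1.le)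

theorem pairwise_disjoint_core (N : ℕ → ℕ) (k : ℕ) (s : Set ℕ) : s.PairwiseDisjoint (core N k) :=
  fun _ _ _ _ h => (disjoint_coarseCell k h).mono core_subset core_subset

end Cells

/-- The union of all cores of stage `k`. -/
def coreUnion (N : ℕ → ℕ) (k : ℕ) : Set unitInterval := ⋃ m ∈ Finset.range (k + 1), core N k m

theorem measurableSet_coreUnion (N : ℕ → ℕ) (k : ℕ) : MeasurableSet (coreUnion N k) :=
  Finset.measurableSet_biUnion _ fun _ _ => measurableSet_interval _ _

theorem core_subset_coreUnion (N : ℕ → ℕ) {k m : ℕ} (hm : m < k + 1) :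
    core N k m ⊆ coreUnion N k :=
  Set.subset_biUnion_of_mem (u := core N k) (Finset.mem_coe.2 (Finset.mem_range.2 hm))

theorem volume_coreUnion_le (N : ℕ → ℕ) (k : ℕ) :
    volume (coreUnion N k) ≤ ENNReal.ofReal (coreRatio k * (N k : ℝ)⁻¹) := by
  refine (measure_biUnion_finset_le _ _).trans (le_of_eq ?_)
  rw [Finset.sum_congr rfl fun m hm => volume_core (Finset.mem_range.1 hm), Finset.sum_const,
    Finset.card_range, ← ENNReal.ofReal_nsmul, nsmul_eq_mul, width]
  congr 1
  push_cast
  rw [mul_inv]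
  field_simp

theorem ae_eventually_notMem_coreUnion (N : ℕ → ℕ) :
    ∀ᵐ x : unitInterval, ∀ᶠ k in atTop, x ∉ coreUnion N k := by
  refine ae_eventually_notMem (ne_top_of_le_ne_top ?_ (ENNReal.tsum_le_tsum fun k =>
    (volume_coreUnion_le N k).trans (ENNReal.ofReal_le_ofReal (?_ : _ ≤ (2⁻¹ : ℝ) ^ k))))
  · exact (summable_geometric_of_lt_one (by norm_num) (by norm_num)).tsum_ofReal_ne_top
  · refine (mul_le_of_le_one_right (coreRatio_pos k).le ?_).trans (coreRatio_le k)
    exact Nat.cast_inv_le_one _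

/-- At each stage the fine cells cover `[0,1]` up to their countably many endpoints. -/
theorem ae_exists_mem_fineCell (N : ℕ → ℕ) :
    ∀ᵐ x : unitInterval, ∀ k, 0 < N k → ∃ m < k + 1, ∃ i < N k, x ∈ fineCell N k m i := by
  have hc : (Subtype.val ⁻¹' Set.range fun q : ℕ × ℕ × ℕ =>
      (q.2.1 : ℝ) / ((q.1 : ℝ) + 1) + q.2.2 * width N q.1 : Set unitInterval).Countable :=
    (Set.countable_range _).preimage Subtype.val_injective
  filter_upwards [hc.ae_notMem volume] with x hx k hN
  have hx : ∀ m i : ℕ, (m : ℝ) / ((k : ℝ) + 1) + i * width N k ≠ x :=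
    fun m i h => hx ⟨(k, m, i), h⟩
  have hN' : (0 : ℝ) < N k := by exact_mod_cast hN
  have hx₁ : (x : ℝ) < 1 := lt_of_le_of_ne x.2.2 fun h => hx (k + 1) 0 (by
    rw [h]; push_cast; field_simp; simp)
  set j := ⌊(x : ℝ) * ((k + 1) * N k)⌋₊ with hj
  have h₁ : (j : ℝ) ≤ x * ((k + 1) * N k) := Nat.floor_le (mul_nonneg x.2.1 (by positivity))
  have h₂ : (x : ℝ) * ((k + 1) * N k) < j + 1 := Nat.lt_floor_add_one _
  have hdiv : (j : ℝ) = N k * (j / N k : ℕ) + (j % N k : ℕ) := by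
    exact_mod_cast (Nat.div_add_mod j (N k)).symm
  have hjlt : j < N k * (k + 1) := by
    have : (j : ℝ) < N k * (k + 1) := by nlinarith [mul_pos (show (0 : ℝ) < k + 1 by positivity) hN']
    exact_mod_cast this
  have hpos : (0 : ℝ) < (k + 1) * N k := by positivity
  have hleft : ((j / N k : ℕ) : ℝ) / ((k : ℝ) + 1) + (j % N k : ℕ) * width N k
      = j / ((k + 1) * N k) := by
    rw [width, hdiv]; field_simp
  refine ⟨j / N k, Nat.div_lt_of_lt_mul hjlt, j % N k, Nat.mod_lt _ hN, ?_, ?_⟩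
  · refine lt_of_le_of_ne ?_ (hx _ _)
    rwa [hleft, div_le_iff₀ hpos]
  · rw [add_mul, ← add_assoc, hleft, width, one_mul, ← one_div, ← add_div, lt_div_iff₀ hpos]
    exact h₂

/-! ### The basis is a Busemann–Feller basis -/

theorem isOpen_of_mem_coreFamily {N : ℕ → ℕ} {S : Set unitInterval} (hS : S ∈ coreFamily N) :
    IsOpen S := by
  rcases hS with ⟨a, b, -, -, -, rfl⟩ | ⟨k, m, i, -, -, rfl⟩
  · exact isOpen_interval a b
  · exact (isOpen_interval _ _).union (isOpen_interval _ _)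

theorem isFiniteUnion_of_mem_coreFamily {N : ℕ → ℕ} {S : Set unitInterval}
    (hS : S ∈ coreFamily N) : IsFiniteUnionOfOpenIntervals S := by
  classical
  rcases hS with ⟨a, b, ha, hab, hb, rfl⟩ | ⟨k, m, i, hm, hi, rfl⟩
  · refine ⟨{(⟨a, ha, hab.le.trans hb⟩, ⟨b, ha.trans hab.le, hb⟩)}, fun q hq => ?_, ?_⟩
    · rw [Finset.mem_singleton.1 hq]
      exact Subtype.mk_lt_mk.2 hab
    · rw [Finset.set_biUnion_singleton]
      rfl
  · have hw := width_pos (pos_of_gt hi)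
    have hc := mul_pos (coreRatio_pos k) hw
    have h₁ := (fine_right_le (m := m) hi).trans (coarse_right_le hm)
    have h₂ := (core_right_le (N := N)).trans (coarse_right_le hm)
    have h₃ : (0 : ℝ) ≤ m / ((k : ℝ) + 1) := by positivity
    have h₄ : (0 : ℝ) ≤ i * width N k := by positivity
    refine ⟨{(⟨m / ((k : ℝ) + 1) + i * width N k, by linarith, by nlinarith⟩,
        ⟨m / ((k : ℝ) + 1) + (i + 1) * width N k, by nlinarith, h₁⟩),
      (⟨m / ((k : ℝ) + 1), h₃, by linarith⟩,
        ⟨m / ((k : ℝ) + 1) + coreRatio k * width N k, by linarith, h₂⟩)}, ?_, ?_⟩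
    · intro q hq
      rcases Finset.mem_insert.1 hq with rfl | hq
      · exact Subtype.mk_lt_mk.2 (by linarith)
      · rw [Finset.mem_singleton.1 hq]
        exact Subtype.mk_lt_mk.2 (by linarith)
    · rw [Finset.set_biUnion_insert, Finset.set_biUnion_singleton]
      rfl

theorem mem_coreFamily_of_mem_basisSets {N : ℕ → ℕ} {S : Set unitInterval}
    (hS : S ∈ basisSets (coreBasis N)) : S ∈ coreFamily N := by
  obtain ⟨x, hx⟩ := Set.mem_iUnion.1 hS
  exact hx.1

theorem isBusemannFellerBasis_coreBasis (N : ℕ → ℕ) :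
    IsBusemannFellerBasis volume (coreBasis N) := by
  refine ⟨⟨fun x S hS => ?_, ?_⟩, fun x => ?_, fun S hS =>
    isOpen_of_mem_coreFamily (mem_coreFamily_of_mem_basisSets hS)⟩
  · have ho := isOpen_of_mem_coreFamily hS.1
    refine ⟨ho.measurableSet, hS.2, ?_, measure_lt_top _ _⟩
    rcases hS.1 with ⟨a, b, ha, hab, hb, rfl⟩ | ⟨k, m, i, hm, hi, rfl⟩
    · rw [volume_interval ha hab.le hb]
      exact ENNReal.ofReal_pos.2 (sub_pos.2 hab)
    · refine lt_of_lt_of_le ?_ (measure_mono Set.subset_union_left)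
      rw [volume_fineCell hm hi]
      exact ENNReal.ofReal_pos.2 (width_pos (pos_of_gt hi))
  · have h₀ : ∀ᵐ x : unitInterval, x ≠ 0 := Measure.ae_ne volume 0
    have h₁ : ∀ᵐ x : unitInterval, x ≠ 1 := Measure.ae_ne volume 1
    filter_upwards [h₀, h₁] with x hx₀ hx₁
    have hx₀ : (0 : ℝ) < x := unitInterval.pos_iff_ne_zero.2 hx₀
    have hx₁ : (x : ℝ) < 1 := unitInterval.lt_one_iff_ne_one.2 hx₁
    have hr : ∀ n : ℕ, (0 : ℝ) < 1 / ((n : ℝ) + 1) := fun n => by positivity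
    refine ⟨fun n => interval (max 0 (x - 1 / ((n : ℝ) + 1))) (min 1 (x + 1 / ((n : ℝ) + 1))),
      fun n => ?_, fun n => 1 / ((n : ℝ) + 1), hr, tendsto_one_div_add_atTop_nhds_zero_nat,
      fun n y hy => ?_⟩
    · have h₁ : max 0 (x - 1 / ((n : ℝ) + 1)) < x := max_lt hx₀ (by linarith [hr n])
      have h₂ : (x : ℝ) < min 1 (x + 1 / ((n : ℝ) + 1)) := lt_min hx₁ (by linarith [hr n])
      exact ⟨Or.inl ⟨_, _, le_max_left _ _, h₁.trans h₂, min_le_left _ _, rfl⟩, h₁, h₂⟩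
    · have h₁ := (max_lt_iff.1 hy.1).2
      have h₂ := (lt_min_iff.1 hy.2).2
      rw [Metric.mem_ball, Subtype.dist_eq, Real.dist_eq, abs_lt]
      constructor <;> linarith
  · ext S
    exact ⟨fun hS => ⟨Set.mem_iUnion.2 ⟨x, hS⟩, hS.2⟩,
      fun hS => ⟨mem_coreFamily_of_mem_basisSets hS.1, hS.2⟩⟩

/-! ### Lebesgue's theorem for intervals -/

/-- Lebesgue's differentiation theorem on `[0,1]`, for intervals that contain `x` but need not be
centred at `x`. -/
theorem ae_exists_lintegral_interval_le {f : unitInterval → ℝ} (hf : Integrable f volume) :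
    ∀ᵐ x : unitInterval, ∀ ε : ℝ≥0∞, 0 < ε → ∃ r > (0 : ℝ), ∀ a b : ℝ, 0 ≤ a → b ≤ 1 →
      x ∈ interval a b → interval a b ⊆ Metric.ball x r →
        ∫⁻ y in interval a b, ‖f y - f x‖ₑ ≤ ε * ENNReal.ofReal (b - a) := by
  set F : ℝ → ℝ := Set.indicator (Set.Icc 0 1) fun t => f (Set.projIcc 0 1 zero_le_one t) with hF
  have hFf : ∀ x : unitInterval, F x = f x := fun x => by
    rw [hF, Set.indicator_of_mem x.2, Set.projIcc_val]
  have hFi : Integrable F volume := by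
    rw [hF, integrable_indicator_iff measurableSet_Icc,
      integrableOn_iff_comap_subtypeVal measurableSet_Icc]
    refine hf.congr (Eventually.of_forall fun x => ?_)
    simp [Set.projIcc_val]
  have h := (IsUnifLocDoublingMeasure.vitaliFamily (volume : Measure ℝ)
    1).ae_tendsto_lintegral_enorm_sub_div_of_integrable hFi
  have h' := (ae_restrict_iff_subtype measurableSet_Icc).1
    (ae_restrict_of_ae (s := Set.Icc (0 : ℝ) 1) h)
  filter_upwards [h'] with x hx ε hε
  have := hx.eventually_le_const hε
  obtain ⟨r, hr, H⟩ := (VitaliFamily.eventually_filterAt_iff _).1 this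
  refine ⟨r, hr, fun a b ha hb hxab hsub => ?_⟩
  have hab : a < b := hxab.1.trans hxab.2
  have key := H (Set.Icc a b) (by
    rw [Real.Icc_eq_closedBall a b]
    refine IsUnifLocDoublingMeasure.closedBall_mem_vitaliFamily_of_dist_le_mul _ ?_ (by linarith)
    rw [Real.dist_eq, abs_le]
    constructor <;> linarith [hxab.1, hxab.2]) (by
    rw [← closure_Ioo hab.ne]
    refine closure_minimal (fun c hc => ?_) Metric.isClosed_closedBall
    exact Metric.ball_subset_closedBall
      (hsub (show (⟨c, ha.trans hc.1.le, hc.2.le.trans hb⟩ : unitInterval) ∈ interval a b from hc)))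
  rw [ENNReal.div_le_iff (by simp [hab]) (by simp), Real.volume_Icc] at key
  refine le_trans (le_of_eq ?_) key
  rw [setLIntegral_congr Ioo_ae_eq_Icc.symm]
  have hmp := unitInterval.measurePreserving_coe.restrict_preimage
    (measurableSet_Ioo (a := a) (b := b))
  have hE := hmp.lintegral_comp_emb (MeasurableEmbedding.subtype_coe measurableSet_Icc)
    fun t => ‖F t - F x‖ₑ
  simp only [hFf] at hE
  rw [Measure.restrict_restrict measurableSet_Ioo, Set.inter_eq_left.2
    (show Set.Ioo a b ⊆ unitInterval from fun t ht => ⟨ha.trans ht.1.le, ht.2.le.trans hb⟩)] at hE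
  simp only [hFf]
  exact hE

/-! ### Exponents for which the basis differentiates -/

/-- Jensen's inequality for the `p`-th power, in its unnormalized form. -/
theorem rpow_lintegral_le {α : Type*} [MeasurableSpace α] {μ : Measure α} {f : α → ℝ} {p : ℝ}
    (hp : 1 ≤ p) (hf : AEStronglyMeasurable f μ) :
    (∫⁻ x, ‖f x‖ₑ ∂μ) ^ p ≤ μ Set.univ ^ (p - 1) * ∫⁻ x, ‖f x‖ₑ ^ p ∂μ := by
  have hp₀ : 0 < p := by linarith
  have h := eLpNorm'_le_eLpNorm'_mul_rpow_measure_univ one_pos hp hf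
  simp only [eLpNorm'_eq_lintegral_enorm, ENNReal.rpow_one, div_one] at h
  refine (ENNReal.rpow_le_rpow h hp₀.le).trans (le_of_eq ?_)
  rw [ENNReal.mul_rpow_of_nonneg _ _ hp₀.le, ← ENNReal.rpow_mul, ← ENNReal.rpow_mul,
    one_div_mul_cancel hp₀.ne', ENNReal.rpow_one, mul_comm, sub_mul, one_div_mul_cancel hp₀.ne',
    one_mul]

/-- The weighted mass of `f` on a core, relative to the length of the fine cells, is controlled by
the `L^p` mass of `f` on that core. -/
theorem volume_coarseCell_mul_rpow_le {N : ℕ → ℕ} {k m : ℕ} {f : unitInterval → ℝ} {p : ℝ}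
    (hp : 1 ≤ p) (hm : m < k + 1) (hf : AEStronglyMeasurable f volume) :
    volume (coarseCell k m) *
        ((∫⁻ y in core N k m, ‖f y‖ₑ) / ENNReal.ofReal (width N k)) ^ p ≤
      N k * ENNReal.ofReal (coreRatio k ^ (p - 1)) * ∫⁻ y in core N k m, ‖f y‖ₑ ^ p := by
  have hp₀ : 0 < p := by linarith
  rcases Nat.eq_zero_or_pos (N k) with h | h
  · -- With no fine cells, the core is empty.
    have hc : core N k m = ∅ := by
      refine Set.eq_empty_of_forall_notMem fun x hx => ?_
      have := hx.1.trans hx.2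
      simp [width, h] at this
    simp [hc, h, hp₀]
  have hw := width_pos h
  have hN : (0 : ℝ) < N k := by exact_mod_cast h
  set W := ENNReal.ofReal (width N k) with hW
  have hW₀ : W ≠ 0 := (ENNReal.ofReal_pos.2 hw).ne'
  have hW₁ : W ≠ ∞ := ENNReal.ofReal_ne_top
  have hvol : volume (coarseCell k m) = N k * W := by
    rw [volume_coarseCell hm, hW, ← ENNReal.ofReal_natCast, ← ENNReal.ofReal_mul hN.le, width]
    congr 1; field_simp
  have hJ := rpow_lintegral_le hp (hf.mono_measure (Measure.restrict_le_self (s := core N k m)))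
  rw [Measure.restrict_apply_univ, volume_core hm, ENNReal.ofReal_mul (coreRatio_pos k).le,
    ENNReal.mul_rpow_of_nonneg _ _ (by linarith : 0 ≤ p - 1),
    ENNReal.ofReal_rpow_of_nonneg (coreRatio_pos k).le (by linarith : 0 ≤ p - 1)] at hJ
  have hWW : W * (W ^ (p - 1) * (W ^ p)⁻¹) = 1 := by
    rw [← ENNReal.rpow_neg, ← ENNReal.rpow_add _ _ hW₀ hW₁]
    nth_rewrite 1 [← ENNReal.rpow_one W]
    rw [← ENNReal.rpow_add _ _ hW₀ hW₁]
    ring_nf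
    exact ENNReal.rpow_zero
  rw [hvol, ENNReal.div_rpow_of_nonneg _ _ hp₀.le, div_eq_mul_inv]
  calc (N k : ℝ≥0∞) * W * ((∫⁻ y in core N k m, ‖f y‖ₑ) ^ p * (W ^ p)⁻¹)
      ≤ N k * W * ((ENNReal.ofReal (coreRatio k ^ (p - 1)) * W ^ (p - 1) *
          ∫⁻ y in core N k m, ‖f y‖ₑ ^ p) * (W ^ p)⁻¹) := by gcongr
    _ = N k * ENNReal.ofReal (coreRatio k ^ (p - 1)) * (∫⁻ y in core N k m, ‖f y‖ₑ ^ p) *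
          (W * (W ^ (p - 1) * (W ^ p)⁻¹)) := by ring
    _ = _ := by rw [hWW, mul_one]

/-- If `∑ N k * coreRatio k ^ (p - 1)` converges, the core attached to the fine cells around
almost every point contributes less and less to the averages of a function in `L^p`. -/
theorem ae_eventually_lintegral_core_le {N : ℕ → ℕ} {f : unitInterval → ℝ} {p : ℝ} (hp : 1 ≤ p)
    (hN : ∑' k, (N k : ℝ≥0∞) * ENNReal.ofReal (coreRatio k ^ (p - 1)) ≠ ∞)
    (hf : AEStronglyMeasurable f volume) (hfp : ∫⁻ x, ‖f x‖ₑ ^ p ≠ ∞) :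
    ∀ᵐ x : unitInterval, ∀ ε : ℝ≥0∞, 0 < ε → ∀ᶠ k in atTop, ∀ m < k + 1, 0 < N k →
      x ∈ coarseCell k m →
        ∫⁻ y in core N k m, ‖f y‖ₑ ≤ ε * ENNReal.ofReal (width N k) := by
  have hp₀ : 0 < p := by linarith
  set a : ℕ → ℕ → ℝ≥0∞ := fun k m =>
    ((∫⁻ y in core N k m, ‖f y‖ₑ) / ENNReal.ofReal (width N k)) ^ p with ha
  set h : ℕ → unitInterval → ℝ≥0∞ := fun k x =>
    ∑ m ∈ Finset.range (k + 1), (coarseCell k m).indicator (fun _ => a k m) x with hh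
  have hm₁ : ∀ k m, Measurable ((coarseCell k m).indicator fun _ => a k m) := fun k m =>
    measurable_const.indicator (measurableSet_interval _ _)
  have hmeas : ∀ k, Measurable (h k) := fun k => Finset.measurable_fun_sum _ fun m _ => hm₁ k m
  have hint : ∀ k, ∫⁻ x, h k x ≤
      N k * ENNReal.ofReal (coreRatio k ^ (p - 1)) * ∫⁻ x, ‖f x‖ₑ ^ p := fun k => by
    rw [lintegral_finsetSum _ fun m _ => hm₁ k m]
    calc ∑ m ∈ Finset.range (k + 1), ∫⁻ x, (coarseCell k m).indicator (fun _ => a k m) x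
        ≤ ∑ m ∈ Finset.range (k + 1), N k * ENNReal.ofReal (coreRatio k ^ (p - 1)) *
            ∫⁻ y in core N k m, ‖f y‖ₑ ^ p := by
          refine Finset.sum_le_sum fun m hm => ?_
          rw [lintegral_indicator_const (show MeasurableSet (coarseCell k m) from
            measurableSet_interval _ _), mul_comm]
          exact volume_coarseCell_mul_rpow_le hp (Finset.mem_range.1 hm) hf
      _ = N k * ENNReal.ofReal (coreRatio k ^ (p - 1)) *
            ∫⁻ y in coreUnion N k, ‖f y‖ₑ ^ p := by
          rw [← Finset.mul_sum, coreUnion, lintegral_biUnion_finset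
            (pairwise_disjoint_core N k _) fun m _ => measurableSet_interval _ _]
      _ ≤ _ := by gcongr; exact Measure.restrict_le_self
  have htot : ∫⁻ x, ∑' k, h k x ≠ ∞ := by
    rw [lintegral_tsum fun k => (hmeas k).aemeasurable]
    refine ne_top_of_le_ne_top ?_ (ENNReal.tsum_le_tsum hint)
    rw [ENNReal.tsum_mul_right]
    exact ENNReal.mul_ne_top hN hfp
  filter_upwards [ae_lt_top (Measurable.tsum hmeas) htot] with x hx ε hε
  have ht := ENNReal.tendsto_atTop_zero_of_tsum_ne_top hx.ne
  filter_upwards [ht.eventually_le_const (ENNReal.rpow_pos_of_nonneg hε hp₀.le)]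
    with k hk m hm hNk hxm
  have h₁ : a k m ≤ ε ^ p := by
    refine le_trans ?_ hk
    have := Finset.single_le_sum (f := fun m => (coarseCell k m).indicator (fun _ => a k m) x)
      (fun _ _ => zero_le) (Finset.mem_range.2 hm)
    rwa [Set.indicator_of_mem hxm] at this
  have h₂ := (ENNReal.rpow_le_rpow_iff hp₀).1 h₁
  rwa [ENNReal.div_le_iff (ENNReal.ofReal_pos.2 (width_pos hNk)).ne' ENNReal.ofReal_ne_top] at h₂

theorem enorm_setAverage_sub_le {α : Type*} [MeasurableSpace α] {μ : Measure α} {f : α → ℝ}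
    {S : Set α} (hf : Integrable f μ) (h₀ : μ S ≠ 0) (h₁ : μ S ≠ ∞) (c : ℝ) :
    ‖(⨍ y in S, f y ∂μ) - c‖ₑ ≤ (∫⁻ y in S, ‖f y - c‖ₑ ∂μ) / μ S := by
  have : Fact (μ S < ∞) := ⟨h₁.lt_top⟩
  have : NeZero (μ.restrict S) := ⟨by simpa using h₀⟩
  have hc : (⨍ y in S, f y ∂μ) - c = ⨍ y in S, (f y - c) ∂μ := by
    rw [average, average, integral_sub hf.restrict.to_average (integrable_const c),
      integral_const, probReal_univ, one_smul]
  rw [hc, average, ← Measure.restrict_apply_univ S, ← laverage_eq]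
  exact enorm_integral_le_lintegral_enorm _

theorem differentiatesLp_coreBasis {N : ℕ → ℕ} {p : ℝ} (hp : 1 ≤ p)
    (hN : ∑' k, (N k : ℝ≥0∞) * ENNReal.ofReal (coreRatio k ^ (p - 1)) ≠ ∞) :
    DifferentiatesLp volume (coreBasis N) (ENNReal.ofReal p) := by
  intro f hf
  have hp₀ : 0 < p := by linarith
  have hfi : Integrable f volume := hf.integrable (by simpa using hp)
  have hfp : ∫⁻ x, ‖f x‖ₑ ^ p ≠ ∞ := by
    have := (eLpNorm_lt_top_iff_lintegral_rpow_enorm_lt_top (ENNReal.ofReal_pos.2 hp₀).ne'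
      ENNReal.ofReal_ne_top).1 hf.2
    rw [ENNReal.toReal_ofReal hp₀.le] at this
    exact this.ne
  filter_upwards [ae_exists_lintegral_interval_le hfi, ae_eventually_notMem_coreUnion N,
    ae_eventually_lintegral_core_le hp hN hf.1 hfp] with x hleb hnot hcore S hS
  obtain ⟨hSB, r, hr₀, hr, hSr⟩ := hS
  rw [tendsto_iff_edist_tendsto_0, ENNReal.tendsto_nhds_zero]
  intro ε hε
  set δ := ε / 3 with hδ
  have hδ₀ : 0 < δ := ENNReal.div_pos hε.ne' (by simp)
  have hδε : 3 * δ = ε := ENNReal.mul_div_cancel (by simp) (by simp)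
  obtain ⟨ρ, hρ, hleb⟩ := hleb δ hδ₀
  have hratio : Tendsto (fun k => ENNReal.ofReal (coreRatio k) * ‖f x‖ₑ) atTop (𝓝 0) := by
    have h₁ : Tendsto coreRatio atTop (𝓝 0) := squeeze_zero (fun k => (coreRatio_pos k).le)
      coreRatio_le (tendsto_pow_atTop_nhds_zero_of_lt_one (by norm_num) (by norm_num))
    have h₂ := ENNReal.Tendsto.mul_const (b := ‖f x‖ₑ) (ENNReal.tendsto_ofReal h₁)
      (Or.inr (by simp))
    simpa using h₂
  obtain ⟨k₀, hk₀⟩ := eventually_atTop.1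
    ((hnot.and (hcore δ hδ₀)).and (hratio.eventually_le_const hδ₀))
  -- Sets of the first `k₀` stages are too long to fit into small balls.
  have hlong : ∀ᶠ n in atTop, ∀ k < k₀, 0 < N k → 2 * r n < width N k := by
    have h₂r : Tendsto (fun n => 2 * r n) atTop (𝓝 0) := by simpa using hr.const_mul 2
    have := (Finset.eventually_all (Finset.range k₀) (l := atTop)
      (p := fun k n => 0 < N k → 2 * r n < width N k)).2 fun k _ => by
        by_cases h : 0 < N k
        · filter_upwards [h₂r.eventually_lt_const (width_pos h)] with n hn _ using hn
        · exact Eventually.of_forall fun n hn => absurd hn h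
    filter_upwards [this] with n hn k hk using hn k (Finset.mem_range.2 hk)
  filter_upwards [hlong, hr.eventually_lt_const hρ] with n hlong hrρ
  have hball : S n ⊆ Metric.ball x ρ := (hSr n).trans (Metric.ball_subset_ball hrρ.le)
  obtain ⟨hmeas, -, hpos, hfin⟩ := (isBusemannFellerBasis_coreBasis N).1.1 x (S n) (hSB n)
  rw [edist_eq_enorm_sub]
  refine (enorm_setAverage_sub_le hfi hpos.ne' hfin.ne (f x)).trans ?_
  rw [ENNReal.div_le_iff hpos.ne' hfin.ne]
  rcases (hSB n).1 with ⟨a, b, ha, hab, hb, hE⟩ | ⟨k, m, i, hm, hi, hE⟩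
  · have := hleb a b ha hb (hE ▸ (hSB n).2) (hE ▸ hball)
    rw [hE, volume_interval ha hab.le hb]
    refine this.trans ?_
    gcongr
    exact ENNReal.div_le_of_le_mul (le_mul_of_one_le_right' (by norm_num))
  · have hNk : 0 < N k := pos_of_gt hi
    have hw := width_pos hNk
    have hl₀ : (0 : ℝ) ≤ m / ((k : ℝ) + 1) + i * width N k := by positivity
    have hl₁ := (fine_right_le (m := m) hi).trans (coarse_right_le hm)
    have hfineball : fineCell N k m i ⊆ S n := hE ▸ Set.subset_union_left
    have hk : k₀ ≤ k := by
      by_contra! hlt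
      have h₁ := sub_le_of_interval_subset_ball hl₀ (by nlinarith) hl₁
        (hfineball.trans (hSr n))
      have h₂ := hlong k hlt hNk
      linarith
    obtain ⟨⟨hnot, hcore⟩, hratio⟩ := hk₀ k hk
    have hx : x ∈ fineCell N k m i := by
      have hxS : x ∈ fineCell N k m i ∪ core N k m := hE ▸ (hSB n).2
      exact hxS.resolve_right fun h => hnot (core_subset_coreUnion N hm h)
    have h₁ := hleb _ _ hl₀ hl₁ hx (hfineball.trans hball)
    rw [show (m : ℝ) / ((k : ℝ) + 1) + (i + 1) * width N k -
      (m / ((k : ℝ) + 1) + i * width N k) = width N k by ring] at h₁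
    have h₂ := hcore m hm hNk (fineCell_subset hi hx)
    set W := ENNReal.ofReal (width N k) with hW
    have h₃ : ∫⁻ y in core N k m, ‖f y - f x‖ₑ ≤ δ * W + δ * W := by
      calc ∫⁻ y in core N k m, ‖f y - f x‖ₑ
          ≤ ∫⁻ y in core N k m, (‖f y‖ₑ + ‖f x‖ₑ) := lintegral_mono fun y => enorm_sub_le
        _ = (∫⁻ y in core N k m, ‖f y‖ₑ) + ENNReal.ofReal (coreRatio k) * ‖f x‖ₑ * W := by
          rw [lintegral_add_right _ measurable_const, setLIntegral_const, volume_core hm,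
            ENNReal.ofReal_mul (coreRatio_pos k).le]
          ring
        _ ≤ _ := by gcongr
    calc ∫⁻ y in S n, ‖f y - f x‖ₑ
        ≤ (∫⁻ y in fineCell N k m i, ‖f y - f x‖ₑ) + ∫⁻ y in core N k m, ‖f y - f x‖ₑ := by
          rw [hE]; exact lintegral_union_le _ _ _
      _ ≤ δ * W + (δ * W + δ * W) := add_le_add h₁ h₃
      _ = ε * W := by rw [← hδε]; ring
      _ ≤ ε * volume (S n) := by
          gcongr
          rw [hW, ← volume_fineCell hm hi]
          exact measure_mono hfineball

/-! ### Exponents for which the basis does not differentiate -/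

/-- The supremum over `k ≥ K` of the functions equal to `(coreRatio k)⁻¹` on the cores of stage
`k` and to `0` elsewhere. -/
noncomputable def coreSpike (N : ℕ → ℕ) (K : ℕ) (x : unitInterval) : ℝ≥0∞ :=
  ⨆ k, (coreUnion N (k + K)).indicator (fun _ => (ENNReal.ofReal (coreRatio (k + K)))⁻¹) x

theorem measurable_coreSpike (N : ℕ → ℕ) (K : ℕ) : Measurable (coreSpike N K) :=
  Measurable.iSup fun _ => measurable_const.indicator (measurableSet_coreUnion _ _)

theorem lintegral_coreSpike_rpow_le {N : ℕ → ℕ} {p : ℝ} (hp : 1 ≤ p) (K : ℕ)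
    (hN : ∀ k, 0 < N k) :
    ∫⁻ x, coreSpike N K x ^ p ≤
      ∑' k, ((N (k + K) : ℝ≥0∞) * ENNReal.ofReal (coreRatio (k + K) ^ (p - 1)))⁻¹ := by
  have hp₀ : 0 < p := by linarith
  calc ∫⁻ x, coreSpike N K x ^ p
      ≤ ∫⁻ x, ∑' k, (coreUnion N (k + K)).indicator
          (fun _ => (ENNReal.ofReal (coreRatio (k + K)))⁻¹ ^ p) x := by
        refine lintegral_mono fun x => ?_
        rw [← ENNReal.le_rpow_inv_iff hp₀]
        refine iSup_le fun k => ?_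
        rw [ENNReal.le_rpow_inv_iff hp₀]
        refine le_trans (le_of_eq ?_) (ENNReal.le_tsum k)
        by_cases hx : x ∈ coreUnion N (k + K) <;> simp [hx, hp₀]
    _ = ∑' k, (ENNReal.ofReal (coreRatio (k + K)))⁻¹ ^ p * volume (coreUnion N (k + K)) := by
        rw [lintegral_tsum fun k =>
          (measurable_const.indicator (measurableSet_coreUnion _ _)).aemeasurable]
        exact tsum_congr fun k => lintegral_indicator_const (measurableSet_coreUnion _ _) _
    _ ≤ _ := by
        refine ENNReal.tsum_le_tsum fun k => ?_
        generalize k + K = j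
        have hτ := coreRatio_pos j
        have hNj : (0 : ℝ) < N j := by exact_mod_cast hN j
        grw [volume_coreUnion_le]
        rw [← ENNReal.ofReal_inv_of_pos hτ, ENNReal.ofReal_rpow_of_pos (inv_pos.2 hτ),
          ← ENNReal.ofReal_natCast, ← ENNReal.ofReal_mul hNj.le,
          ← ENNReal.ofReal_inv_of_pos (by positivity), ← ENNReal.ofReal_mul (by positivity)]
        refine le_of_eq (congrArg _ ?_)
        rw [Real.rpow_sub_one hτ.ne', Real.inv_rpow hτ.le]
        field_simp

/-- A function that is at least `(coreRatio k)⁻¹` on a core has average at least `1 / 2` on the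
union of this core with any of its fine cells. -/
theorem half_le_setAverage {N : ℕ → ℕ} {k m i : ℕ} {f : unitInterval → ℝ}
    (hf : Integrable f volume) (hf₀ : ∀ x, 0 ≤ f x) (hm : m < k + 1) (hi : i < N k)
    (hcore : ∀ᵐ x, x ∈ core N k m → (coreRatio k)⁻¹ ≤ f x) :
    1 / 2 ≤ ⨍ y in fineCell N k m i ∪ core N k m, f y := by
  have hτ := coreRatio_pos k
  have hw := width_pos (pos_of_gt hi)
  set S := fineCell N k m i ∪ core N k m
  have hc : volume.real (core N k m) = coreRatio k * width N k := by
    rw [measureReal_def, volume_core hm, ENNReal.toReal_ofReal (by positivity)]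
  have hJ : volume.real (fineCell N k m i) = width N k := by
    rw [measureReal_def, volume_fineCell hm hi, ENNReal.toReal_ofReal hw.le]
  have hS : volume.real S ≤ 2 * width N k := by
    refine (measureReal_union_le _ _).trans ?_
    rw [hc, hJ]
    linarith [coreRatio_mul_width_le N k]
  have hS₀ : 0 < volume.real S := by
    refine lt_of_lt_of_le ?_ (measureReal_mono Set.subset_union_left)
    rwa [hJ]
  have h₁ : width N k ≤ ∫ y in S, f y := by
    calc width N k = ∫ _ in core N k m, (coreRatio k)⁻¹ := by
          rw [setIntegral_const, hc, smul_eq_mul]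
          field_simp
      _ ≤ ∫ y in core N k m, f y :=
          setIntegral_mono_on_ae (integrable_const _).integrableOn hf.integrableOn
            (measurableSet_interval _ _) hcore
      _ ≤ ∫ y in S, f y := setIntegral_mono_set hf.integrableOn
            (Eventually.of_forall hf₀) (Eventually.of_forall fun y hy => Or.inr hy)
  rw [setAverage_eq, smul_eq_mul, ← div_eq_inv_mul, le_div_iff₀ hS₀]
  linarith

theorem not_differentiatesLp_coreBasis {N : ℕ → ℕ} {p : ℝ} (hp : 1 ≤ p)
    (hN : ∑' k, ((N k : ℝ≥0∞) * ENNReal.ofReal (coreRatio k ^ (p - 1)))⁻¹ ≠ ∞) :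
    ¬ DifferentiatesLp volume (coreBasis N) (ENNReal.ofReal p) := by
  intro hdiff
  have hp₀ : 0 < p := by linarith
  have hNpos : ∀ k, 0 < N k := fun k => by
    have := ENNReal.ne_top_of_tsum_ne_top hN k
    rw [ne_eq, ENNReal.inv_eq_top, mul_eq_zero, not_or] at this
    exact Nat.pos_of_ne_zero (by exact_mod_cast this.1)
  have htail := ENNReal.tendsto_sum_nat_add _ hN
  have key : ∀ K, ENNReal.ofReal (1 / 2) ^ p ≤
      ∑' k, ((N (k + K) : ℝ≥0∞) * ENNReal.ofReal (coreRatio (k + K) ^ (p - 1)))⁻¹ := fun K => by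
    have hint := lintegral_coreSpike_rpow_le hp K hNpos
    have hintlt : ∫⁻ x, coreSpike N K x ^ p < ∞ := by
      refine hint.trans_lt (lt_of_le_of_lt ?_ hN.lt_top)
      exact ENNReal.tsum_comp_le_tsum_of_injective (add_left_injective K) _
    have hfin : ∀ᵐ x, coreSpike N K x < ∞ := by
      filter_upwards [ae_lt_top ((measurable_coreSpike N K).pow_const p) hintlt.ne] with x hx
      exact (ENNReal.rpow_lt_top_iff_of_pos hp₀).1 hx
    set f : unitInterval → ℝ := fun x => (coreSpike N K x).toReal with hf
    have hfL : MemLp f (ENNReal.ofReal p) volume := by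
      refine ⟨(measurable_coreSpike N K).ennreal_toReal.aestronglyMeasurable, ?_⟩
      rw [eLpNorm_lt_top_iff_lintegral_rpow_enorm_lt_top (ENNReal.ofReal_pos.2 hp₀).ne'
        ENNReal.ofReal_ne_top, ENNReal.toReal_ofReal hp₀.le]
      refine lt_of_le_of_lt (lintegral_mono fun x => ?_) hintlt
      rw [hf, Real.enorm_eq_ofReal ENNReal.toReal_nonneg]
      gcongr
      exact ENNReal.ofReal_toReal_le
    have hfi : Integrable f volume := hfL.integrable (by simpa using hp)
    have hge : ∀ᵐ x, ENNReal.ofReal (1 / 2) ≤ coreSpike N K x := by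
      filter_upwards [hdiff f hfL, ae_exists_mem_fineCell N] with x hx hcell
      choose m hm i hi hmem using fun n : ℕ => hcell (n + K) (hNpos _)
      have hD : ∀ n : ℕ, (0 : ℝ) < 1 / (((n + K : ℕ) : ℝ) + 1) := fun n => by positivity
      have hcon : ContractsTo (coreBasis N)
          (fun n => fineCell N (n + K) (m n) (i n) ∪ core N (n + K) (m n)) x := by
        refine ⟨fun n => ⟨Or.inr ⟨n + K, m n, i n, hm n, hi n, rfl⟩, Or.inl (hmem n)⟩,
          fun n => 1 / (((n + K : ℕ) : ℝ) + 1), hD, ?_, fun n y hy => ?_⟩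
        · exact (tendsto_add_atTop_iff_nat (f := fun n : ℕ => 1 / ((n : ℝ) + 1)) K).2
            tendsto_one_div_add_atTop_nhds_zero_nat
        · have hy' : y ∈ coarseCell (n + K) (m n) :=
            hy.elim (fun h => fineCell_subset (hi n) h) fun h => core_subset h
          have hx' := fineCell_subset (hi n) (hmem n)
          have h₁ := hy'.1
          have h₂ := hy'.2
          have h₃ := hx'.1
          have h₄ := hx'.2
          rw [add_div] at h₂ h₄
          rw [Metric.mem_ball, Subtype.dist_eq, Real.dist_eq, abs_lt]
          constructor <;> linarith
      have hhalf : (1 : ℝ) / 2 ≤ f x := by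
        refine ge_of_tendsto' (hx _ hcon) fun n => half_le_setAverage hfi
          (fun _ => ENNReal.toReal_nonneg) (hm n) (hi n) ?_
        filter_upwards [hfin] with y hy hyc
        have h₁ : (ENNReal.ofReal (coreRatio (n + K)))⁻¹ ≤ coreSpike N K y := by
          refine le_trans (le_of_eq ?_) (le_iSup _ n)
          rw [Set.indicator_of_mem (core_subset_coreUnion N (hm n) hyc)]
        have h₂ := ENNReal.toReal_mono hy.ne h₁
        rwa [ENNReal.toReal_inv, ENNReal.toReal_ofReal (coreRatio_pos _).le] at h₂
      exact ENNReal.ofReal_le_of_le_toReal hhalf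
    refine le_trans ?_ hint
    calc ENNReal.ofReal (1 / 2) ^ p = ∫⁻ _ : unitInterval, ENNReal.ofReal (1 / 2) ^ p := by simp
      _ ≤ ∫⁻ x, coreSpike N K x ^ p := lintegral_mono_ae <| by
        filter_upwards [hge] with x hx
        gcongr
  have := ge_of_tendsto' htail key
  have hpos : 0 < ENNReal.ofReal (1 / 2) ^ p :=
    ENNReal.rpow_pos (ENNReal.ofReal_pos.2 (by norm_num)) ENNReal.ofReal_ne_top
  exact absurd this (not_le.2 hpos)

/-! ### The choice of the numbers of fine cells -/

theorem coreRatio_rpow (k : ℕ) (s : ℝ) : coreRatio k ^ s = 2 ^ (-(s * (k : ℝ) ^ 2)) := by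
  rw [coreRatio, ← Real.rpow_natCast, Real.inv_rpow zero_le_two, ← Real.rpow_neg zero_le_two,
    ← Real.rpow_mul zero_le_two]
  congr 1
  push_cast
  ring

theorem tsum_ofReal_two_rpow_ne_top {E : ℕ → ℝ} {c : ℝ} (hc : c < 0)
    (hE : ∀ᶠ k : ℕ in atTop, E k ≤ c * k) : ∑' k, ENNReal.ofReal (2 ^ E k) ≠ ∞ := by
  refine Summable.tsum_ofReal_ne_top ?_
  have hg : Summable fun k : ℕ => ((2 : ℝ) ^ c) ^ k :=
    summable_geometric_of_lt_one (by positivity) (Real.rpow_lt_one_of_one_lt_of_neg one_lt_two hc)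
  refine hg.of_norm_bounded_eventually_nat ?_
  filter_upwards [hE] with k hk
  rw [Real.norm_of_nonneg (by positivity), ← Real.rpow_mul_natCast zero_le_two]
  exact Real.rpow_le_rpow_of_exponent_le one_le_two hk

theorem eventually_quadratic_le {a : ℝ} (ha : a < 0) (b : ℝ) :
    ∀ᶠ k : ℕ in atTop, a * (k : ℝ) ^ 2 + b * k ≤ -1 * k := by
  filter_upwards [tendsto_natCast_atTop_atTop.eventually_ge_atTop ((b + 1) / -a)] with k hk
  rw [div_le_iff₀ (by linarith)] at hk
  nlinarith [(Nat.cast_nonneg k : (0 : ℝ) ≤ k)]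

/-- The numbers `⌈2 ^ (q * k ^ 2 + σ * k)⌉` of fine cells per coarse cell. Since
`coreRatio k ^ s = 2 ^ (-s * k ^ 2)`, the product with `coreRatio k ^ s` changes its behaviour at
`s = q`, where the sign of `σ` decides. -/
noncomputable def cellCount (q σ : ℝ) (k : ℕ) : ℕ := ⌈(2 : ℝ) ^ (q * (k : ℝ) ^ 2 + σ * k)⌉₊

theorem tsum_cellCount_mul_ne_top {q σ s c : ℝ} (hs : 0 < s) (hc : c < 0)
    (h : ∀ᶠ k : ℕ in atTop, (q - s) * (k : ℝ) ^ 2 + σ * k ≤ c * k) :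
    ∑' k, (cellCount q σ k : ℝ≥0∞) * ENNReal.ofReal (coreRatio k ^ s) ≠ ∞ := by
  have h₁ := tsum_ofReal_two_rpow_ne_top hc h
  have h₂ := tsum_ofReal_two_rpow_ne_top neg_one_lt_zero
    (eventually_quadratic_le (neg_neg_of_pos hs) 0)
  refine ne_top_of_le_ne_top (ENNReal.add_ne_top.2 ⟨h₁, h₂⟩) ?_
  rw [← ENNReal.tsum_add]
  refine ENNReal.tsum_le_tsum fun k => ?_
  rw [coreRatio_rpow, ← ENNReal.ofReal_natCast, ← ENNReal.ofReal_mul (Nat.cast_nonneg _),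
    ← ENNReal.ofReal_add (by positivity) (by positivity)]
  refine ENNReal.ofReal_le_ofReal ?_
  calc (cellCount q σ k : ℝ) * 2 ^ (-(s * (k : ℝ) ^ 2))
      ≤ (2 ^ (q * (k : ℝ) ^ 2 + σ * k) + 1) * 2 ^ (-(s * (k : ℝ) ^ 2)) := by
        gcongr
        exact (Nat.ceil_lt_add_one (by positivity)).le
    _ = _ := by
        rw [add_mul, ← Real.rpow_add two_pos, one_mul]
        ring_nf

theorem tsum_inv_cellCount_mul_ne_top {q σ s c : ℝ} (hc : c < 0)
    (h : ∀ᶠ k : ℕ in atTop, (s - q) * (k : ℝ) ^ 2 + -σ * k ≤ c * k) :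
    ∑' k, ((cellCount q σ k : ℝ≥0∞) * ENNReal.ofReal (coreRatio k ^ s))⁻¹ ≠ ∞ := by
  refine ne_top_of_le_ne_top (tsum_ofReal_two_rpow_ne_top hc h) (ENNReal.tsum_le_tsum fun k => ?_)
  rw [coreRatio_rpow, ← ENNReal.ofReal_natCast, ← ENNReal.ofReal_mul (Nat.cast_nonneg _),
    show (s - q) * (k : ℝ) ^ 2 + -σ * k = -(q * (k : ℝ) ^ 2 + σ * k + -(s * (k : ℝ) ^ 2)) by ring,
    Real.rpow_neg zero_le_two (q * (k : ℝ) ^ 2 + σ * k + -(s * (k : ℝ) ^ 2)),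
    ENNReal.ofReal_inv_of_pos (by positivity), Real.rpow_add two_pos]
  gcongr
  exact Nat.le_ceil _

theorem DifferentiatesLp.mono {X : Type*} [MetricSpace X] [MeasurableSpace X] {μ : Measure X}
    [IsFiniteMeasure μ] {B : X → Set (Set X)} {p q : ℝ≥0∞} (h : DifferentiatesLp μ B p)
    (hpq : p ≤ q) : DifferentiatesLp μ B q :=
  fun f hf => h f (hf.mono_exponent hpq)

/-- Intervals alone differentiate `L^p` for all `p ≥ 1`. -/
theorem differentiatesLp_coreBasis_zero {p : ℝ≥0∞} (hp : 1 ≤ p) :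
    DifferentiatesLp volume (coreBasis 0) p := by
  have := differentiatesLp_coreBasis (N := 0) le_rfl (by simp)
  rw [ENNReal.ofReal_one] at this
  exact this.mono hp

theorem differentiatesLp_cellCount_neg_one_iff {p₀ : ℝ≥0} (hp₀ : 1 < p₀) {p : ℝ≥0∞}
    (hp : 1 ≤ p) :
    DifferentiatesLp volume (coreBasis (cellCount (p₀ - 1) (-1))) p ↔ (p₀ : ℝ≥0∞) ≤ p := by
  have hp₀' : (1 : ℝ) < p₀ := by exact_mod_cast hp₀
  constructor
  · contrapose!
    intro hlt
    lift p to ℝ≥0 using hlt.ne_top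
    have hp' : (1 : ℝ) ≤ p := by exact_mod_cast hp
    have hlt' : (p : ℝ) < p₀ := by exact_mod_cast hlt
    rw [← ENNReal.ofReal_coe_nnreal]
    exact not_differentiatesLp_coreBasis hp' (tsum_inv_cellCount_mul_ne_top neg_one_lt_zero
      (eventually_quadratic_le (by linarith) _))
  · intro h
    refine DifferentiatesLp.mono ?_ h
    rw [← ENNReal.ofReal_coe_nnreal]
    exact differentiatesLp_coreBasis hp₀'.le (tsum_cellCount_mul_ne_top (by linarith)
      neg_one_lt_zero (Eventually.of_forall fun k => by simp))

theorem differentiatesLp_cellCount_one_iff {p₀ : ℝ≥0} (hp₀ : 1 ≤ p₀) {p : ℝ≥0∞} :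
    DifferentiatesLp volume (coreBasis (cellCount (p₀ - 1) 1)) p ↔ (p₀ : ℝ≥0∞) < p := by
  have hp₀' : (1 : ℝ) ≤ p₀ := by exact_mod_cast hp₀
  constructor
  · contrapose!
    intro hle h
    have h' := h.mono hle
    rw [← ENNReal.ofReal_coe_nnreal] at h'
    exact not_differentiatesLp_coreBasis hp₀' (tsum_inv_cellCount_mul_ne_top neg_one_lt_zero
      (Eventually.of_forall fun k => by simp)) h'
  · intro h
    -- An intermediate exponent is finite also when `p = ∞`.
    obtain ⟨r, hr₀, hr⟩ := ENNReal.lt_iff_exists_nnreal_btwn.1 h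
    have hr₀' : (p₀ : ℝ) < r := by exact_mod_cast hr₀
    refine DifferentiatesLp.mono ?_ hr.le
    rw [← ENNReal.ofReal_coe_nnreal]
    exact differentiatesLp_coreBasis (by linarith) (tsum_cellCount_mul_ne_top (by linarith)
      neg_one_lt_zero (eventually_quadratic_le (by linarith) _))

theorem corollary1p2 (p₀ : ℝ≥0) (hp₀ : 1 ≤ p₀) :
    ∃ Bge Bgt : Set.Icc (0 : ℝ) 1 → Set (Set (Set.Icc (0 : ℝ) 1)),
      (IsBusemannFellerBasis volume Bge ∧
        (∀ S ∈ basisSets Bge, IsFiniteUnionOfOpenIntervals S) ∧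
        ∀ p : ℝ≥0∞, 1 ≤ p → (DifferentiatesLp volume Bge p ↔ (p₀ : ℝ≥0∞) ≤ p)) ∧
      (IsBusemannFellerBasis volume Bgt ∧
        (∀ S ∈ basisSets Bgt, IsFiniteUnionOfOpenIntervals S) ∧
        ∀ p : ℝ≥0∞, 1 ≤ p → (DifferentiatesLp volume Bgt p ↔ (p₀ : ℝ≥0∞) < p)) := by
  have hge : ∃ N : ℕ → ℕ, ∀ p : ℝ≥0∞, 1 ≤ p →
      (DifferentiatesLp volume (coreBasis N) p ↔ (p₀ : ℝ≥0∞) ≤ p) := by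
    rcases hp₀.eq_or_lt with rfl | h
    · exact ⟨0, fun p hp => iff_of_true (differentiatesLp_coreBasis_zero hp) (by simpa using hp)⟩
    · exact ⟨_, fun p hp => differentiatesLp_cellCount_neg_one_iff h hp⟩
  obtain ⟨N, hN⟩ := hge
  exact ⟨coreBasis N, coreBasis (cellCount (p₀ - 1) 1),
    ⟨isBusemannFellerBasis_coreBasis _,
      fun S hS => isFiniteUnion_of_mem_coreFamily (mem_coreFamily_of_mem_basisSets hS), hN⟩,
    isBusemannFellerBasis_coreBasis _,
    fun S hS => isFiniteUnion_of_mem_coreFamily (mem_coreFamily_of_mem_basisSets hS),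
    fun p _ => differentiatesLp_cellCount_one_iff hp₀⟩
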